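/- Let $n,m\ge 0$ be integers and let $A\in\mathbb{R}^{m\times m}$ be a diagonal matrix with positive diagonal entries. Let $u\in C^2(\mathbb{R}^n;\mathbb{R}^m)$ be bounded and satisfy the Ginzburg–Landau system $$A\,\Delta u(x)=\left(|u(x)|^2-1\right)u(x)\qquad\text{for all }x\in\mathbb{R}^n,$$ where $\Delta$ is the Laplacian acting on each component of $u$ and $|\cdot|$ is the Euclidean norm. Then $|u(x)|\le 1$ for every $x\in\mathbb{R}^n$. If, in addition, $u$ is not constant, then $|u(x)|<1$ for every $x\in\mathbb{R}^n$. -/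

import Mathlib

open scoped Laplacian

/-!
The function `|u|²` satisfies `Δ |u|² = 2 ⟪Δ u, u⟫ + 2 |∇u|²` (`laplacian_norm_sq`), and by the
system `⟪Δ u, u⟫ = (|u|² - 1) ∑ uᵢ² / aᵢ`, where the weighted sum is comparable to `|u|²`. Both
claims are then maximum principles for this scalar function.

If `|u(x)|² = 1 + δ` with `δ > 0`, then `Δ |u|²` is bounded below by a positive constant wherever
`|u|² ≥ 1 + δ`. As `|u|²` is bounded, a maximum of `|u|² - ε ‖· - x‖²` is a point of that kind where
`Δ |u|² ≤ 2 n ε` (`exists_ge_laplacian_le`), which is impossible for small `ε`.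

Hence `w = 1 - |u|²` is nonnegative, and `Δ w ≤ K w` for a constant `K`. If `w` vanishes somewhere,
it vanishes identically, by the strong minimum principle (`eq_zero_of_laplacian_le_mul`), proved by
Hopf's barrier argument with a polynomial barrier. Then `|u|² ≡ 1`, so `Δ u = 0` and
`0 = Δ |u|² = 2 |∇u|²`, and `u` is constant.
-/

/-! ### The Laplacian: second-order test and squared norms -/

section Laplace

variable {E : Type*} [NormedAddCommGroup E] [InnerProductSpace ℝ E]
  {F : Type*} [NormedAddCommGroup F] [InnerProductSpace ℝ F]

theorem ContDiff.differentiable_fderiv_of_two {f : E → F} (hf : ContDiff ℝ 2 f) :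
    Differentiable ℝ (fderiv ℝ f) :=
  (hf.fderiv_right (m := 1) (by norm_num)).differentiable (by norm_num)

/-- Second-order necessary condition: at a local minimum the second derivative is nonnegative in
each direction. Otherwise the restriction to a line would have a local maximum as well, hence be
locally constant, with vanishing second derivative. -/
theorem IsLocalMin.fderiv_fderiv_nonneg {f : E → ℝ} {x : E} (h : IsLocalMin f x)
    (hf : ContDiff ℝ 2 f) (e : E) : 0 ≤ fderiv ℝ (fderiv ℝ f) x e e := by
  by_contra! hneg
  set g : ℝ → ℝ := fun t => f (x + t • e) with hg
  have hline (t : ℝ) : HasDerivAt (fun t : ℝ => x + t • e) e t := by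
    simpa using ((hasDerivAt_id t).smul_const e).const_add x
  have hd : deriv g = fun t => fderiv ℝ f (x + t • e) e := by
    funext t
    exact ((hf.differentiable (by norm_num) _).hasFDerivAt.comp_hasDerivAt t (hline t)).deriv
  have hdd : deriv (deriv g) 0 = fderiv ℝ (fderiv ℝ f) x e e := by
    rw [hd]
    have h1 := (hf.differentiable_fderiv_of_two (x + (0 : ℝ) • e)).hasFDerivAt.comp_hasDerivAt 0
      (hline 0)
    simpa using (h1.clm_apply (hasDerivAt_const (0 : ℝ) e)).deriv
  have hcont : Continuous g := by
    have := hf.continuous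
    fun_prop
  have hmin : IsLocalMin g 0 := by
    have hc : ContinuousAt (fun t : ℝ => x + t • e) 0 := (hline 0).continuousAt
    have h' : IsLocalMin f (x + (0 : ℝ) • e) := by simpa using h
    exact hc.eventually h'
  have hmax : IsLocalMax g 0 :=
    isLocalMax_of_deriv_deriv_neg (by rw [hdd]; exact hneg) hmin.deriv_eq_zero hcont.continuousAt
  have hconst : g =ᶠ[nhds 0] fun _ => g 0 := by
    filter_upwards [hmin, hmax] with t h1 h2
    exact le_antisymm h2 h1
  have h0 : deriv (deriv g) 0 = 0 := by
    rw [hconst.deriv.deriv_eq]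
    simp
  rw [hdd] at h0
  exact hneg.ne h0

theorem contDiff_norm_sub_sq (p : E) : ContDiff ℝ 2 fun y : E => ‖y - p‖ ^ 2 :=
  (contDiff_id.sub contDiff_const).norm_sq ℝ

variable [FiniteDimensional ℝ E]

theorem laplacian_eq_sum_fderiv_fderiv (f : E → F) (x : E) :
    (Δ f) x = ∑ i, fderiv ℝ (fderiv ℝ f) x (stdOrthonormalBasis ℝ E i)
      (stdOrthonormalBasis ℝ E i) := by
  simp [InnerProductSpace.laplacian_eq_iteratedFDeriv_stdOrthonormalBasis,
    iteratedFDeriv_two_apply]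

theorem IsLocalMin.laplacian_nonneg {f : E → ℝ} {x : E} (h : IsLocalMin f x)
    (hf : ContDiff ℝ 2 f) : 0 ≤ (Δ f) x := by
  rw [laplacian_eq_sum_fderiv_fderiv]
  exact Finset.sum_nonneg fun i _ => h.fderiv_fderiv_nonneg hf _

theorem laplacian_norm_sq {f : E → F} (hf : ContDiff ℝ 2 f) (x : E) :
    (Δ fun y => ‖f y‖ ^ 2) x = 2 * inner ℝ ((Δ f) x) (f x)
      + 2 * ∑ i, ‖fderiv ℝ f x (stdOrthonormalBasis ℝ E i)‖ ^ 2 := by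
  have hd : Differentiable ℝ f := hf.differentiable (by norm_num)
  have hdd := hf.differentiable_fderiv_of_two
  have hn : ContDiff ℝ 2 fun y => ‖f y‖ ^ 2 := hf.norm_sq ℝ
  have key (e : E) : fderiv ℝ (fderiv ℝ fun y => ‖f y‖ ^ 2) x e e
      = 2 * inner ℝ (fderiv ℝ (fderiv ℝ f) x e e) (f x) + 2 * ‖fderiv ℝ f x e‖ ^ 2 := by
    have h1 : (fun y => fderiv ℝ (fun y => ‖f y‖ ^ 2) y e)
        = fun y => 2 * inner ℝ (f y) (fderiv ℝ f y e) := by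
      funext y
      rw [(hd y).hasFDerivAt.norm_sq.fderiv]
      simp
    have h2 : fderiv ℝ (fun y => fderiv ℝ (fun y => ‖f y‖ ^ 2) y e) x e
        = fderiv ℝ (fderiv ℝ fun y => ‖f y‖ ^ 2) x e e := by
      rw [fderiv_clm_apply (hn.differentiable_fderiv_of_two x) (differentiableAt_const e)]
      simp
    have h3 : fderiv ℝ (fun y => fderiv ℝ f y e) x e = fderiv ℝ (fderiv ℝ f) x e e := by
      rw [fderiv_clm_apply (hdd x) (differentiableAt_const e)]
      simp
    have hde : DifferentiableAt ℝ (fun y => fderiv ℝ f y e) x :=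
      (hdd x).clm_apply (differentiableAt_const e)
    rw [← h2, h1, fderiv_const_mul ((hd x).inner ℝ hde)]
    rw [smul_apply, fderiv_inner_apply ℝ (hd x) hde, h3,
      real_inner_self_eq_norm_sq, real_inner_comm, smul_eq_mul]
    ring
  rw [laplacian_eq_sum_fderiv_fderiv, laplacian_eq_sum_fderiv_fderiv, sum_inner, Finset.mul_sum,
    Finset.mul_sum, ← Finset.sum_add_distrib]
  exact Finset.sum_congr rfl fun i _ => key _

theorem laplacian_norm_sub_sq (p x : E) :
    (Δ fun y : E => ‖y - p‖ ^ 2) x = 2 * (Module.finrank ℝ E : ℝ) := by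
  have hc : ContDiff ℝ 2 fun y : E => y - p := contDiff_id.sub contDiff_const
  have hfd : fderiv ℝ (fun y : E => y - p) = fun _ => ContinuousLinearMap.id ℝ E := by
    funext y
    exact ((hasFDerivAt_id y).sub_const p).fderiv
  rw [laplacian_norm_sq hc, laplacian_eq_sum_fderiv_fderiv, hfd]
  simp

theorem laplacian_const_sub {f : E → ℝ} (hf : ContDiff ℝ 2 f) (c : ℝ) (x : E) :
    (Δ fun y => c - f y) x = -(Δ f) x := by
  have h := (contDiffAt_const (c := c) (x := x)).laplacian_sub hf.contDiffAt
  have h' : ((fun _ => c) - f) = fun y => c - f y := rfl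
  rw [h'] at h
  simpa using h

theorem laplacian_const_mul {f : E → ℝ} (hf : ContDiff ℝ 2 f) (c : ℝ) (x : E) :
    (Δ fun y => c * f y) x = c * (Δ f) x :=
  InnerProductSpace.laplacian_smul c hf.contDiffAt

theorem laplacian_fun_add {f g : E → ℝ} (hf : ContDiff ℝ 2 f) (hg : ContDiff ℝ 2 g) (x : E) :
    (Δ fun y => f y + g y) x = (Δ f) x + (Δ g) x :=
  hf.contDiffAt.laplacian_add hg.contDiffAt

theorem laplacian_fun_sub {f g : E → ℝ} (hf : ContDiff ℝ 2 f) (hg : ContDiff ℝ 2 g) (x : E) :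
    (Δ fun y => f y - g y) x = (Δ f) x - (Δ g) x :=
  hf.contDiffAt.laplacian_sub hg.contDiffAt

/-! ### Maximum principles -/

/-- A maximum principle at infinity, in the manner of Omori and Yau: a `C²` function that is
bounded above has points where it is at least as large as at a given point and where its Laplacian
is almost nonpositive. Such a point is a maximum of `f - ε ‖· - x₀‖²`. -/
theorem exists_ge_laplacian_le {f : E → ℝ} (hf : ContDiff ℝ 2 f) {C : ℝ} (hC : ∀ x, f x ≤ C)
    (x₀ : E) {ε : ℝ} (hε : 0 < ε) :
    ∃ y, f x₀ ≤ f y ∧ (Δ f) y ≤ ε * (2 * (Module.finrank ℝ E : ℝ)) := by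
  have hs := contDiff_norm_sub_sq x₀
  have hes : ContDiff ℝ 2 fun y => ε * ‖y - x₀‖ ^ 2 := contDiff_const.mul hs
  have hg : ContDiff ℝ 2 fun y => ε * ‖y - x₀‖ ^ 2 - f y := hes.sub hf
  have hev : ∀ᶠ y in Filter.cocompact E,
      ε * ‖x₀ - x₀‖ ^ 2 - f x₀ ≤ ε * ‖y - x₀‖ ^ 2 - f y := by
    have ht : Filter.Tendsto (fun y : E => ε * ‖y - x₀‖ ^ 2) (Filter.cocompact E) Filter.atTop := by
      have h1 : Filter.Tendsto (fun y : E => ‖y - x₀‖) (Filter.cocompact E) Filter.atTop := by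
        simpa [dist_eq_norm] using tendsto_dist_right_cocompact_atTop x₀
      exact ((Filter.tendsto_pow_atTop two_ne_zero).comp h1).const_mul_atTop hε
    filter_upwards [ht.eventually_ge_atTop (C - f x₀)] with y hy
    have := hC y
    simp only [sub_self, norm_zero]
    linarith
  obtain ⟨y, hy⟩ := hg.continuous.exists_forall_le' x₀ hev
  refine ⟨y, ?_, ?_⟩
  · have h1 := hy x₀
    simp only [sub_self, norm_zero] at h1
    have : 0 ≤ ε * ‖y - x₀‖ ^ 2 := by positivity
    linarith
  · have hmin : IsLocalMin (fun y => ε * ‖y - x₀‖ ^ 2 - f y) y := Filter.Eventually.of_forall hy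
    have h2 := hmin.laplacian_nonneg hg
    rw [laplacian_fun_sub hes hf, laplacian_const_mul hs, laplacian_norm_sub_sq] at h2
    linarith

/-- A barrier for Hopf's argument: near a point `y ≠ p`, the function `ρ + M ρ²` with
`ρ = ‖y - p‖² - ‖· - p‖²` and `M` large is a strict subsolution of `Δ h = K h`, and it is
nonnegative only in the closed ball about `p` through `y`. -/
theorem exists_barrier {p y : E} (hpy : y ≠ p) (K : ℝ) :
    ∃ h : E → ℝ, ContDiff ℝ 2 h ∧ h y = 0 ∧
      ∀ᶠ x in nhds y, K * h x < (Δ h) x ∧ (0 ≤ h x → dist x p ≤ dist y p) := by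
  set s : E → ℝ := fun x => ‖x - p‖ ^ 2 with hs_def
  set R : ℝ := ‖y - p‖ with hR_def
  have hR : 0 < R := norm_pos_iff.2 (sub_ne_zero.2 hpy)
  have hs : ContDiff ℝ 2 s := contDiff_norm_sub_sq p
  set ρ : E → ℝ := fun x => R ^ 2 - s x with hρ_def
  have hρ : ContDiff ℝ 2 ρ := contDiff_const.sub hs
  have hρ2 : ContDiff ℝ 2 fun x => ‖ρ x‖ ^ 2 := hρ.norm_sq ℝ
  set d : ℝ := (Module.finrank ℝ E : ℝ) with hd_def
  -- At `y` the Laplacian of `ρ + M ρ²` is `-2 d + 8 M R²`, which this choice makes equal to `2`.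
  set M : ℝ := (d + 1) / (4 * R ^ 2) with hM_def
  have hM2 : ContDiff ℝ 2 fun x => M * ‖ρ x‖ ^ 2 := contDiff_const.mul hρ2
  have hΔρ (x : E) : (Δ ρ) x = -(2 * d) := by
    rw [hρ_def, laplacian_const_sub hs, laplacian_norm_sub_sq]
  have hgrad (x : E) :
      ∑ i, ‖fderiv ℝ ρ x (stdOrthonormalBasis ℝ E i)‖ ^ 2 = 4 * ‖x - p‖ ^ 2 := by
    have h1 (e : E) : ‖fderiv ℝ ρ x e‖ ^ 2 = 4 * ‖inner ℝ (x - p) e‖ ^ 2 := by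
      have h2 : HasFDerivAt (fun x : E => x - p) (ContinuousLinearMap.id ℝ E) x :=
        (hasFDerivAt_id x).sub_const p
      have h3 := (h2.norm_sq.const_sub (R ^ 2)).fderiv
      rw [show fderiv ℝ ρ x = _ from h3]
      simp only [neg_apply, norm_neg, smul_apply,
        ContinuousLinearMap.comp_id, innerSL_apply_apply, nsmul_eq_mul, norm_mul, mul_pow]
      norm_num
    simp_rw [h1, ← Finset.mul_sum]
    rw [(stdOrthonormalBasis ℝ E).sum_sq_norm_inner_left]
  have hΔ (x : E) : (Δ fun x => ρ x + M * ‖ρ x‖ ^ 2) x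
      = -(2 * d) + M * (2 * (-(2 * d) * ρ x) + 2 * (4 * ‖x - p‖ ^ 2)) := by
    rw [laplacian_fun_add hρ hM2, laplacian_const_mul hρ2, laplacian_norm_sq hρ, hgrad, hΔρ,
      real_inner_eq_re_inner, RCLike.re_to_real]
    simp [mul_comm]
  have hρy : ρ y = 0 := by simp [hρ_def, hs_def, hR_def]
  refine ⟨fun x => ρ x + M * ‖ρ x‖ ^ 2, hρ.add hM2, by simp [hρy], ?_⟩
  have hρc : Continuous ρ := hρ.continuous
  have e1 : ∀ᶠ x in nhds y, K * (ρ x + M * ‖ρ x‖ ^ 2)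
      < (Δ fun x => ρ x + M * ‖ρ x‖ ^ 2) x := by
    simp_rw [hΔ]
    refine ContinuousAt.eventually_lt (by fun_prop) (by fun_prop) ?_
    rw [hρy, ← hR_def]
    have : M * (2 * (4 * R ^ 2)) = 2 * (d + 1) := by
      rw [hM_def]
      field_simp
    simp only [norm_zero]
    nlinarith
  have e2 : ∀ᶠ x in nhds y, 0 < 1 + M * ρ x :=
    ContinuousAt.eventually_lt (by fun_prop) (by fun_prop) (by simp [hρy])
  filter_upwards [e1, e2] with x h1 h2
  refine ⟨h1, fun h3 => ?_⟩
  have h4 : ρ x + M * ‖ρ x‖ ^ 2 = ρ x * (1 + M * ρ x) := by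
    rw [Real.norm_eq_abs, sq_abs]
    ring
  simp only [h4] at h3
  have h5 : 0 ≤ ρ x := nonneg_of_mul_nonneg_left h3 h2
  rw [dist_eq_norm, dist_eq_norm]
  exact le_of_sq_le_sq (by linarith [show ρ x = R ^ 2 - ‖x - p‖ ^ 2 from rfl]) hR.le

/-- The zero set of a nonnegative supersolution of `Δ w = K w` cannot touch the boundary of a ball
whose other points carry positive values. Otherwise, with `h` the barrier at the contact point
`y`, the function `C w - h` would be positive on a small sphere about `y` for large `C`, but vanish
at `y`, and so have an interior minimum with nonpositive value; there its Laplacian is negative. -/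
theorem not_touching_ball {w : E → ℝ} (hw : ContDiff ℝ 2 w) (hw0 : ∀ x, 0 ≤ w x) {K : ℝ}
    (hK : 0 ≤ K) (hΔ : ∀ x, (Δ w) x ≤ K * w x) {p y : E} (hpy : y ≠ p) (hy : w y = 0)
    (hpos : ∀ x, dist x p ≤ dist y p → x ≠ y → 0 < w x) : False := by
  obtain ⟨h, hh, hhy, hev⟩ := exists_barrier hpy K
  obtain ⟨r, hr, hball⟩ := Metric.nhds_basis_closedBall.eventually_iff.1 hev
  set S : Set E := Metric.sphere y r ∩ Metric.closedBall p (dist y p) with hS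
  have hSc : IsCompact S := (isCompact_sphere y r).inter_right Metric.isClosed_closedBall
  have hSpos : ∀ x ∈ S, 0 < w x := fun x hx =>
    hpos x hx.2 (Metric.ne_of_mem_sphere hx.1 hr.ne')
  obtain ⟨B, hB⟩ := hSc.bddAbove_image
    (hh.continuous.continuousOn.div hw.continuous.continuousOn fun x hx => (hSpos x hx).ne')
  set C : ℝ := |B| + 1 with hC
  have hCpos : 0 < C := by positivity
  have hCw : ContDiff ℝ 2 fun x => C * w x := contDiff_const.mul hw
  have hg : ContDiff ℝ 2 fun x => C * w x - h x := hCw.sub hh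
  have hsphere : ∀ x ∈ Metric.sphere y r, 0 < C * w x - h x := by
    intro x hx
    by_cases hx0 : 0 ≤ h x
    · have hxS : x ∈ S := ⟨hx, (hball (Metric.sphere_subset_closedBall hx)).2 hx0⟩
      have h1 : h x / w x ≤ B := hB (Set.mem_image_of_mem _ hxS)
      rw [div_le_iff₀ (hSpos x hxS)] at h1
      nlinarith [hSpos x hxS, le_abs_self B]
    · have := mul_nonneg hCpos.le (hw0 x)
      linarith
  obtain ⟨z, hz, hzmin⟩ := (isCompact_closedBall y r).exists_isMinOn
    ⟨y, Metric.mem_closedBall_self hr.le⟩ hg.continuous.continuousOn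
  have hz0 : C * w z - h z ≤ 0 := by
    simpa [hy, hhy] using hzmin (Metric.mem_closedBall_self hr.le)
  have hzball : z ∈ Metric.ball y r := by
    refine lt_of_le_of_ne (Metric.mem_closedBall.1 hz) fun hzr => ?_
    exact absurd (hsphere z hzr) (not_lt.2 hz0)
  have hloc : IsLocalMin (fun x => C * w x - h x) z :=
    hzmin.isLocalMin (Filter.mem_of_superset (Metric.isOpen_ball.mem_nhds hzball)
      Metric.ball_subset_closedBall)
  have h2 := hloc.laplacian_nonneg hg
  rw [laplacian_fun_sub hCw hh, laplacian_const_mul hw] at h2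
  have h3 := (hball hz).1
  have h4 := mul_le_mul_of_nonneg_left (hΔ z) hCpos.le
  have h5 := mul_le_mul_of_nonneg_left hz0 hK
  linarith

/-- Strong minimum principle on the whole space: a nonnegative supersolution of `Δ w = K w` that
vanishes somewhere vanishes identically. -/
theorem eq_zero_of_laplacian_le_mul {w : E → ℝ} (hw : ContDiff ℝ 2 w) (hw0 : ∀ x, 0 ≤ w x) {K : ℝ}
    (hK : 0 ≤ K) (hΔ : ∀ x, (Δ w) x ≤ K * w x) {x₀ : E} (hx₀ : w x₀ = 0) (x : E) : w x = 0 := by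
  by_contra hx
  have hZ : IsClosed {z | w z = 0} := isClosed_eq hw.continuous continuous_const
  obtain ⟨y, hy, hdist⟩ := hZ.exists_infDist_eq_dist ⟨x₀, hx₀⟩ x
  have hyx : y ≠ x := by
    rintro rfl
    exact hx hy
  -- Halving the ball about `x` makes `y` the only zero of `w` in the closed ball.
  refine not_touching_ball hw hw0 hK hΔ (p := midpoint ℝ x y) (y := y) ?_ hy ?_
  · simpa [eq_comm] using hyx
  · intro z hz hzy
    refine lt_of_le_of_ne (hw0 z) fun hwz => hzy ?_
    have h1 : dist x y ≤ dist x z := hdist ▸ Metric.infDist_le_dist_of_mem hwz.symm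
    have h2 : ‖(z - x) - (1 / 2 : ℝ) • (y - x)‖ ≤ ‖(1 / 2 : ℝ) • (y - x)‖ := by
      have e1 : z - midpoint ℝ x y = (z - x) - (1 / 2 : ℝ) • (y - x) := by
        rw [midpoint_eq_smul_add, invOf_eq_inv]
        module
      have e2 : y - midpoint ℝ x y = (1 / 2 : ℝ) • (y - x) := by
        rw [midpoint_eq_smul_add, invOf_eq_inv]
        module
      rwa [dist_eq_norm, dist_eq_norm, e1, e2] at hz
    rw [dist_comm x y, dist_comm x z, dist_eq_norm, dist_eq_norm] at h1
    have h3 := pow_le_pow_left₀ (norm_nonneg _) h1 2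
    have h4 := pow_le_pow_left₀ (norm_nonneg _) h2 2
    rw [norm_sub_sq_real, real_inner_smul_right] at h4
    have h5 := norm_sub_sq_real (z - x) (y - x)
    rw [sub_sub_sub_cancel_right] at h5
    have h6 : ‖z - y‖ ^ 2 = 0 := le_antisymm (by linarith) (sq_nonneg _)
    rwa [sq_eq_zero_iff, norm_eq_zero, sub_eq_zero] at h6

end Laplace

/-! ### The Ginzburg–Landau system -/

theorem exists_weighted_sum_sq_bounds {m : ℕ} (a : Fin m → ℝ) (ha : ∀ i, 0 < a i) :
    ∃ c C : ℝ, 0 < c ∧ 0 ≤ C ∧ ∀ v : EuclideanSpace ℝ (Fin m),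
      c * ‖v‖ ^ 2 ≤ ∑ i, v i ^ 2 / a i ∧ ∑ i, v i ^ 2 / a i ≤ C * ‖v‖ ^ 2 := by
  have hinv (i : Fin m) : 0 ≤ (a i)⁻¹ := (inv_pos.2 (ha i)).le
  have hsum : 0 ≤ ∑ i, a i := Finset.sum_nonneg fun i _ => (ha i).le
  refine ⟨(1 + ∑ i, a i)⁻¹, ∑ i, (a i)⁻¹, by positivity, Finset.sum_nonneg fun i _ => hinv i,
    fun v => ?_⟩
  rw [EuclideanSpace.real_norm_sq_eq, Finset.mul_sum, Finset.mul_sum]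
  constructor <;> refine Finset.sum_le_sum fun i _ => ?_
  · rw [div_eq_inv_mul]
    refine mul_le_mul_of_nonneg_right (inv_anti₀ (ha i) ?_) (sq_nonneg _)
    linarith [Finset.single_le_sum (fun i _ => (ha i).le) (Finset.mem_univ i)]
  · rw [div_eq_inv_mul]
    exact mul_le_mul_of_nonneg_right
      (Finset.single_le_sum (fun i _ => hinv i) (Finset.mem_univ i)) (sq_nonneg _)

theorem Matrix.IsDiag.toEuclideanLin_apply_apply {m : ℕ} {A : Matrix (Fin m) (Fin m) ℝ}
    (hA : A.IsDiag) (v : EuclideanSpace ℝ (Fin m)) (i : Fin m) :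
    Matrix.toEuclideanLin A v i = A i i * v i := by
  rw [← hA.diagonal_diag]
  simp [Matrix.toLpLin_apply, Matrix.mulVec_diagonal]

theorem mainTheorem3 (n m : ℕ)
    (A : Matrix (Fin m) (Fin m) ℝ) (hA : A.IsDiag) (hpos : ∀ i, 0 < A i i)
    (u : EuclideanSpace ℝ (Fin n) → EuclideanSpace ℝ (Fin m))
    (hu : ContDiff ℝ 2 u) (hbdd : ∃ C : ℝ, ∀ x, ‖u x‖ ≤ C)
    (hsol : ∀ x, Matrix.toEuclideanLin A ((Δ u) x) = (‖u x‖ ^ 2 - 1) • u x) :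
    (∀ x, ‖u x‖ ≤ 1) ∧
      ((¬ ∃ c : EuclideanSpace ℝ (Fin m), ∀ x, u x = c) → ∀ x, ‖u x‖ < 1) := by
  obtain ⟨c, C, hc, hC, hq⟩ := exists_weighted_sum_sq_bounds (fun i => A i i) hpos
  have hΔu (x) (i : Fin m) : (Δ u) x i = (‖u x‖ ^ 2 - 1) * (u x i / A i i) := by
    have h := congrArg (fun v : EuclideanSpace ℝ (Fin m) => v i) (hsol x)
    simp only [hA.toEuclideanLin_apply_apply, PiLp.smul_apply, smul_eq_mul] at h
    have := (hpos i).ne'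
    field_simp
    linarith
  have hinner (x) : inner ℝ ((Δ u) x) (u x) = (‖u x‖ ^ 2 - 1) * ∑ i, u x i ^ 2 / A i i := by
    rw [PiLp.inner_apply, Finset.mul_sum]
    refine Finset.sum_congr rfl fun i _ => ?_
    rw [hΔu]
    simp only [RCLike.inner_apply, conj_trivial]
    ring
  have hf : ContDiff ℝ 2 fun x => ‖u x‖ ^ 2 := hu.norm_sq ℝ
  have hΔf (x) : 2 * ((‖u x‖ ^ 2 - 1) * ∑ i, u x i ^ 2 / A i i) ≤ (Δ fun x => ‖u x‖ ^ 2) x := by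
    rw [laplacian_norm_sq hu, hinner]
    have : 0 ≤ ∑ i, ‖fderiv ℝ u x (stdOrthonormalBasis ℝ _ i)‖ ^ 2 :=
      Finset.sum_nonneg fun i _ => sq_nonneg _
    linarith
  have hle (x) : ‖u x‖ ^ 2 ≤ 1 := by
    by_contra! hx
    obtain ⟨B, hB⟩ := hbdd
    set δ : ℝ := ‖u x‖ ^ 2 - 1 with hδ
    have hδ0 : 0 < δ := by linarith
    -- Any `ε` with `2 n ε < 2 c δ` contradicts `Δ |u|² ≥ 2 c δ` where `|u|² ≥ 1 + δ`.
    obtain ⟨y, hy1, hy2⟩ := exists_ge_laplacian_le hf (C := B ^ 2)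
      (fun y => pow_le_pow_left₀ (norm_nonneg _) (hB y) 2) x (ε := c * δ / (n + 1)) (by positivity)
    have h1 := hΔf y
    have h2 : c ≤ ∑ i, u y i ^ 2 / A i i := by
      refine le_trans ?_ (hq (u y)).1
      exact le_mul_of_one_le_right hc.le (by linarith)
    have h3 : δ * c ≤ (‖u y‖ ^ 2 - 1) * ∑ i, u y i ^ 2 / A i i :=
      mul_le_mul (by linarith) h2 hc.le (by linarith)
    have h4 : c * δ / (n + 1) * (2 * n) < 2 * (c * δ) := by
      rw [div_mul_eq_mul_div, div_lt_iff₀ (by positivity)]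
      nlinarith [mul_pos hc hδ0]
    rw [finrank_euclideanSpace_fin] at hy2
    linarith
  have hle1 (x) : ‖u x‖ ≤ 1 := by
    simpa using hle x
  refine ⟨hle1, fun hnc x => lt_of_le_of_ne (hle1 x) fun hx => hnc ?_⟩
  have hw : ContDiff ℝ 2 fun x => 1 - ‖u x‖ ^ 2 := contDiff_const.sub hf
  have hone (y) : ‖u y‖ ^ 2 = 1 := by
    have h := eq_zero_of_laplacian_le_mul hw (fun z => sub_nonneg.2 (hle z)) (K := 2 * C)
      (by positivity) (fun z => ?_) (x₀ := x) (by simp [hx]) y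
    · linarith
    rw [laplacian_const_sub hf]
    have h1 := hΔf z
    have h2 : ∑ i, u z i ^ 2 / A i i ≤ C :=
      (hq (u z)).2.trans (mul_le_of_le_one_right hC (hle z))
    nlinarith [mul_le_mul_of_nonneg_left h2 (sub_nonneg.2 (hle z))]
  -- With `|u|² ≡ 1` the identity for `Δ |u|²` leaves only the gradient term.
  have hgrad (y) : fderiv ℝ u y = 0 := by
    have h := laplacian_norm_sq hu y
    rw [hinner, show (fun y => ‖u y‖ ^ 2) = fun _ => (1 : ℝ) from funext hone, hone,
      InnerProductSpace.laplacian_const] at h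
    have h0 : ∑ i, ‖fderiv ℝ u y (stdOrthonormalBasis ℝ _ i)‖ ^ 2 = 0 := by
      simp only [Pi.zero_apply] at h
      linarith
    rw [Finset.sum_eq_zero_iff_of_nonneg fun i _ => sq_nonneg _] at h0
    refine ContinuousLinearMap.coe_injective
      ((stdOrthonormalBasis ℝ (EuclideanSpace ℝ (Fin n))).toBasis.ext fun i => ?_)
    simpa using h0 i (Finset.mem_univ i)
  exact ⟨u x, fun y => is_const_of_fderiv_eq_zero (hu.differentiable (by norm_num)) hgrad y x⟩
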